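/- Let $\mathbf u=u_0u_1u_2\cdots$ be a Sturmian sequence over $\{a,b\}$ in which the letter $b$ has frequency an irrational number $\alpha\in(0,1)$, and let $\mathbf b$ be a Sturmian sequence over $\{2,3\}$. (A sequence is $C$-balanced if, for any two of its factors of the same length and any letter, the numbers of occurrences of that letter in the two factors differ by at most $C$; a Sturmian sequence is a binary $1$-balanced sequence that is not eventually periodic; the frequency of a letter is the limit of its relative frequencies in the prefixes.) Let $\mathbf v$ be the colouring of $\mathbf u$ by $1^\omega$ and $\mathbf b$, that is, the sequence over $\{1,2,3\}$ obtained from $\mathbf u$ by replacing every $a$ with $1$ and the subsequence of all $b$'s with $\mathbf b$. Then: 1. $\mathbf v$ is $2$-balanced; moreover, the letter $3$ has a frequency $\gamma\in(0,1)$ in $\mathbf b$, and $\mathbf v$ is not $1$-balanced if $\alpha\notin\left\{\frac1{1+\gamma},\frac1{2-\gamma}\right\}$. 2. For every integer $n\ge1$, $$\mathcal C_{\mathbf v}(n)\le P_\alpha(n)+(n+1)\lceil n\alpha\rceil\qquad\text{and}\qquad \mathcal C^{ab}_{\mathbf v}(n)\le 4 .$$ Here $\mathcal C_{\mathbf v}(n)$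 is the number of factors of $\mathbf v$ of length $n$, $\mathcal C^{ab}_{\mathbf v}(n)$ is the number of distinct Parikh vectors (vectors of letter counts) of these factors, and $P_\alpha(n)$ is the number of factors with $\lfloor(1-\alpha)n\rfloor$ letters $a$ and $\lceil n\alpha\rceil$ letters $b$ of a Sturmian sequence over $\{a,b\}$ in which $b$ has frequency $\alpha$; the inequality holds whichever such sequence is used to compute $P_\alpha(n)$. -/

import Mathlib

namespace InfWord

/-- The two-letter alphabet `{a, b}`. -/
inductive AB where
  | a : AB
  | b : AB
  deriving DecidableEq

variable {A : Type*}

/-- The word `s i, s (i+1), …, s (i+n-1)` read in the sequence `s`. -/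
def window (s : ℕ → A) (i n : ℕ) : List A :=
  (List.range n).map fun k => s (i + k)

/-- The language of a sequence: the set of all its factors. -/
def language (s : ℕ → A) : Set (List A) :=
  {w | ∃ i : ℕ, w = window s i w.length}

/-- The factors of length `n`. -/
def factors (s : ℕ → A) (n : ℕ) : Set (List A) :=
  {w | w ∈ language s ∧ w.length = n}

/-- A sequence with finitely many letters has finitely many factors of each length, so that the
cardinalities below are genuine. -/
theorem factors_finite (s : ℕ → A) (hs : (Set.range s).Finite) (n : ℕ) : (factors s n).Finite := by
  have : Finite (Set.range s) := hs
  refine ((List.finite_length_eq (Set.range s) n).image (List.map Subtype.val)).subset ?_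
  rintro w ⟨⟨i, hi⟩, hn⟩
  refine ⟨(List.range n).map fun k => ⟨s (i + k), Set.mem_range_self _⟩, by simp, ?_⟩
  rw [hi, hn]
  simp [window]

/-- Factor complexity. -/
noncomputable def factorComplexity (s : ℕ → A) (n : ℕ) : ℕ :=
  (factors s n).ncard

/-- The Parikh vector of a word: the number of occurrences of each letter. -/
def parikh [DecidableEq A] (w : List A) : A → ℕ := fun c => w.count c

/-- Abelian complexity: the number of Parikh vectors of factors of length `n`. -/
noncomputable def abelianComplexity [DecidableEq A] (s : ℕ → A) (n : ℕ) : ℕ :=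
  (parikh '' factors s n).ncard

/-- `s` is `C`-balanced. -/
def IsBalanced [DecidableEq A] (C : ℕ) (s : ℕ → A) : Prop :=
  ∀ x ∈ language s, ∀ y ∈ language s, x.length = y.length →
    ∀ c : A, |(x.count c : ℤ) - (y.count c : ℤ)| ≤ (C : ℤ)

/-- `s` is of the form `x y^ω` with `y` non-empty. -/
def IsEventuallyPeriodic (s : ℕ → A) : Prop :=
  ∃ N p : ℕ, 0 < p ∧ ∀ n : ℕ, N ≤ n → s (n + p) = s n

/-- `s` is a Sturmian sequence over the two-letter alphabet `{x, y}`: a binary, 1-balanced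
sequence that is not eventually periodic. -/
def IsSturmian [DecidableEq A] (x y : A) (s : ℕ → A) : Prop :=
  x ≠ y ∧ (∀ n, s n = x ∨ s n = y) ∧ IsBalanced 1 s ∧ ¬ IsEventuallyPeriodic s

/-- The letter `c` has frequency `f` in `s`. -/
def HasFrequency [DecidableEq A] (s : ℕ → A) (c : A) (f : ℝ) : Prop :=
  Filter.Tendsto (fun n : ℕ => ((window s 0 n).count c : ℝ) / (n : ℝ)) Filter.atTop (nhds f)

/-- The colouring of `u` by `sa` and `sb`: the subsequence of all `a`'s of `u` is replaced by `sa`,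
the subsequence of all `b`'s by `sb`. -/
def colour (u : ℕ → AB) (sa sb : ℕ → A) : ℕ → A := fun n =>
  match u n with
  | AB.a => sa ((window u 0 n).count AB.a)
  | AB.b => sb ((window u 0 n).count AB.b)

/-- The number of factors of `w` with Parikh vector `(⌊(1-α)n⌋, ⌈nα⌉)`. For a Sturmian sequence `w`
over `{a, b}` in which `b` has frequency `α`, this is the quantity `P_α(n)`. -/
noncomputable def parikhCount (w : ℕ → AB) (α : ℝ) (n : ℕ) : ℕ :=
  {x : List AB | x ∈ language w ∧
    parikh x AB.a = ⌊(1 - α) * (n : ℝ)⌋₊ ∧ parikh x AB.b = ⌈(n : ℝ) * α⌉₊}.ncard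

end InfWord

/-! A factor of the coloured sequence is a factor of `u` whose `b`'s carry a factor of `b`, of
length the number of those `b`'s. Balance of `u` leaves two consecutive values for that number, and
balance of `b` leaves two counts of each letter for each value. This gives 2-balance and at most
four Parikh vectors.

For the factor complexity, a factor of `u` with `k` letters `b` has at most `k + 1` colourings, and
`k` is `⌊nα⌋` or `⌈nα⌉`. Summing over the at most `n + 1` factors of `u` gives the bound, the
factors with the larger `k` being counted by `P_α(n)`. Any Sturmian sequence of the same slope may
be used there, since the slope determines the language (`IsSturmian.language_subset`).

For the failure of 1-balance, the letters 1, 2, 3 have frequencies `1 - α`, `α(1 - γ)`, `αγ`. These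
are distinct because `γ` is irrational and `α` avoids the two excluded values. A 1-balanced sequence
over three letters with distinct positive frequencies is eventually periodic
(`IsBalanced.isEventuallyPeriodic`), which would make `u` eventually periodic. -/

namespace InfWord

/-! ### Windows, balance and letter frequencies -/

section Windows

variable {A : Type*}

@[simp] theorem window_length (s : ℕ → A) (i n : ℕ) : (window s i n).length = n := by
  simp [window]

@[simp] theorem window_zero (s : ℕ → A) (i : ℕ) : window s i 0 = [] := rfl

theorem window_add (s : ℕ → A) (i m n : ℕ) :
    window s i (m + n) = window s i m ++ window s (i + m) n := by
  simp [window, List.range_add, Function.comp_def, add_assoc]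

theorem window_one (s : ℕ → A) (i : ℕ) : window s i 1 = [s i] := rfl

theorem window_succ (s : ℕ → A) (i n : ℕ) :
    window s i (n + 1) = s i :: window s (i + 1) n := by
  rw [add_comm n 1, window_add, window_one]; rfl

theorem window_succ' (s : ℕ → A) (i n : ℕ) :
    window s i (n + 1) = window s i n ++ [s (i + n)] := by
  rw [window_add, window_one]

theorem mem_language_iff {s : ℕ → A} {w : List A} :
    w ∈ language s ↔ ∃ i n, w = window s i n := by
  constructor
  · rintro ⟨i, h⟩
    exact ⟨i, _, h⟩
  · rintro ⟨i, n, rfl⟩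
    exact ⟨i, by simp⟩

theorem window_mem_language (s : ℕ → A) (i n : ℕ) : window s i n ∈ language s :=
  mem_language_iff.2 ⟨i, n, rfl⟩

theorem factors_eq_range (s : ℕ → A) (n : ℕ) :
    factors s n = Set.range fun i => window s i n := by
  ext w
  constructor
  · rintro ⟨⟨i, h⟩, rfl⟩
    exact ⟨i, h.symm⟩
  · rintro ⟨i, rfl⟩
    exact ⟨window_mem_language s i n, by simp⟩

theorem mem_window_iff {s : ℕ → A} {i n : ℕ} {c : A} :
    c ∈ window s i n ↔ ∃ k < n, s (i + k) = c := by
  simp [window]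

theorem language_tail {s : ℕ → A} {c : A} {l : List A} (h : c :: l ∈ language s) :
    l ∈ language s := by
  obtain ⟨i, n, h⟩ := mem_language_iff.1 h
  cases n with
  | zero => simp at h
  | succ n =>
    rw [window_succ] at h
    rw [(List.cons.inj h).2]
    exact window_mem_language _ _ _

theorem language_of_append {s : ℕ → A} {l t : List A} (h : l ++ t ∈ language s) :
    l ∈ language s := by
  obtain ⟨i, n, h⟩ := mem_language_iff.1 h
  have hn : n = l.length + t.length := by
    rw [← List.length_append, h, window_length]
  rw [hn, window_add] at h
  rw [(List.append_inj h (by simp)).1]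
  exact window_mem_language _ _ _

variable [DecidableEq A]

theorem isBalanced_iff {C : ℕ} {s : ℕ → A} :
    IsBalanced C s ↔ ∀ (i j n : ℕ) (c : A),
      |((window s i n).count c : ℤ) - ((window s j n).count c : ℤ)| ≤ C := by
  constructor
  · intro h i j n c
    exact h _ (window_mem_language s i n) _ (window_mem_language s j n) (by simp) c
  · intro h x hx y hy hxy c
    obtain ⟨i, n, rfl⟩ := mem_language_iff.1 hx
    obtain ⟨j, m, rfl⟩ := mem_language_iff.1 hy
    simp only [window_length] at hxy
    subst hxy
    exact h i j n c

theorem IsBalanced.count_le_succ {s : ℕ → A} (h : IsBalanced 1 s) (i j n : ℕ) (c : A) :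
    (window s i n).count c ≤ (window s j n).count c + 1 := by
  have := (abs_le.1 (isBalanced_iff.1 h i j n c)).2
  push_cast at this
  omega

theorem IsBalanced.exists_count_eq {s : ℕ → A} (h : IsBalanced 1 s) (n : ℕ) (c : A) :
    ∃ m, ∀ i, (window s i n).count c = m ∨ (window s i n).count c = m + 1 := by
  have hne : (Set.range fun i => (window s i n).count c).Nonempty := Set.range_nonempty _
  obtain ⟨j, hj⟩ := Nat.sInf_mem hne
  refine ⟨sInf (Set.range fun i => (window s i n).count c), fun i => ?_⟩
  have h1 : sInf (Set.range fun i => (window s i n).count c) ≤ (window s i n).count c :=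
    Nat.sInf_le ⟨i, rfl⟩
  have h2 := h.count_le_succ i j n c
  simp only at hj
  omega

theorem count_window_mul_le {s : ℕ → A} {c : A} {n M : ℕ}
    (h : ∀ i, (window s i n).count c ≤ M) (i k : ℕ) : (window s i (k * n)).count c ≤ k * M := by
  induction k with
  | zero => simp
  | succ k ih =>
    rw [Nat.succ_mul, Nat.succ_mul, window_add, List.count_append]
    exact add_le_add ih (h _)

theorem le_count_window_mul {s : ℕ → A} {c : A} {n M : ℕ}
    (h : ∀ i, M ≤ (window s i n).count c) (i k : ℕ) : k * M ≤ (window s i (k * n)).count c := by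
  induction k with
  | zero => simp
  | succ k ih =>
    rw [Nat.succ_mul, Nat.succ_mul, window_add, List.count_append]
    exact add_le_add ih (h _)

theorem HasFrequency.tendsto_mul {s : ℕ → A} {c : A} {f : ℝ} (hf : HasFrequency s c f) {n : ℕ}
    (hn : 0 < n) :
    Filter.Tendsto (fun k : ℕ => ((window s 0 (k * n)).count c : ℝ) / (k : ℝ)) Filter.atTop
      (nhds (n * f)) := by
  have h1 : Filter.Tendsto (fun k : ℕ => k * n) Filter.atTop Filter.atTop :=
    Filter.tendsto_id.atTop_mul_const' hn
  refine ((hf.comp h1).const_mul (n : ℝ)).congr fun k => ?_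
  have : (n : ℝ) ≠ 0 := by positivity
  rcases eq_or_ne k 0 with rfl | hk
  · simp
  simp only [Function.comp]
  push_cast
  field_simp

/-- The prefix of length `k * n` is a concatenation of `k` windows of length `n`, so a bound valid
for all of them passes to the average. -/
theorem HasFrequency.mul_le {s : ℕ → A} {c : A} {f : ℝ} (hf : HasFrequency s c f) {n M : ℕ}
    (h : ∀ i, (window s i n).count c ≤ M) : n * f ≤ M := by
  rcases Nat.eq_zero_or_pos n with rfl | hn
  · simp
  refine le_of_tendsto (hf.tendsto_mul hn) ?_
  filter_upwards [Filter.eventually_gt_atTop 0] with k hk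
  rw [div_le_iff₀ (by positivity), mul_comm (M : ℝ)]
  exact_mod_cast count_window_mul_le h 0 k

theorem HasFrequency.le_mul {s : ℕ → A} {c : A} {f : ℝ} (hf : HasFrequency s c f) {n M : ℕ}
    (h : ∀ i, M ≤ (window s i n).count c) : M ≤ n * f := by
  rcases Nat.eq_zero_or_pos n with rfl | hn
  · simpa using h 0
  refine ge_of_tendsto (hf.tendsto_mul hn) ?_
  filter_upwards [Filter.eventually_gt_atTop 0] with k hk
  rw [le_div_iff₀ (by positivity), mul_comm (M : ℝ)]
  exact_mod_cast le_count_window_mul h 0 k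

theorem HasFrequency.mul_le_count_add_one {s : ℕ → A} {c : A} {f : ℝ} (hf : HasFrequency s c f)
    (hs : IsBalanced 1 s) (i n : ℕ) : n * f ≤ (window s i n).count c + 1 := by
  exact_mod_cast hf.mul_le (M := (window s i n).count c + 1) fun j => hs.count_le_succ j i n c

theorem HasFrequency.count_le_mul_add_one {s : ℕ → A} {c : A} {f : ℝ} (hf : HasFrequency s c f)
    (hs : IsBalanced 1 s) (i n : ℕ) : (window s i n).count c ≤ n * f + 1 := by
  -- The subtraction is truncated; at count 0 the bound is trivial, and `h2` below holds in either
  -- case.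
  have := hf.le_mul (n := n) (M := (window s i n).count c - 1) fun j => by
    have := hs.count_le_succ i j n c
    omega
  have h2 : ((window s i n).count c : ℝ) ≤ ((window s i n).count c - 1 : ℕ) + 1 := by
    norm_cast; omega
  linarith

/-- Balance puts the count within 1 of `n * f`; irrationality makes this strict, and the open
interval contains only two integers. -/
theorem HasFrequency.count_eq_floor {s : ℕ → A} {c : A} {f : ℝ} (hf : HasFrequency s c f)
    (hs : IsBalanced 1 s) (hirr : Irrational f) (hf0 : 0 < f) {n : ℕ} (hn : 1 ≤ n) (i : ℕ) :
    (window s i n).count c = ⌊n * f⌋₊ ∨ (window s i n).count c = ⌊n * f⌋₊ + 1 := by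
  have h1 := hf.mul_le_count_add_one hs i n
  have h2 := hf.count_le_mul_add_one hs i n
  have hi : Irrational (n * f) := hirr.natCast_mul (by omega)
  have h3 := Nat.floor_le (show 0 ≤ n * f by positivity)
  have h4 := Nat.lt_floor_add_one (n * f)
  have h5 : n * f ≠ (((window s i n).count c + 1 : ℕ) : ℝ) := hi.ne_nat _
  have h6 : (⌊n * f⌋₊ : ℝ) ≠ n * f := fun h => hi.ne_nat _ h.symm
  have h7 : n * f < (((window s i n).count c + 1 : ℕ) : ℝ) := lt_of_le_of_ne (by exact_mod_cast h1) h5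
  have h8 : ((⌊n * f⌋₊ : ℕ) : ℝ) < (((window s i n).count c + 1 : ℕ) : ℝ) := by linarith
  have h9 : (((window s i n).count c : ℕ) : ℝ) < ((⌊n * f⌋₊ + 2 : ℕ) : ℝ) := by
    push_cast; linarith
  have h10 := Nat.cast_lt.1 h8
  have h11 := Nat.cast_lt.1 h9
  omega

/-- Balance makes the count in prefixes, increased by 1, subadditive; Fekete's lemma gives the
limit. -/
theorem IsBalanced.exists_hasFrequency {s : ℕ → A} (hs : IsBalanced 1 s) (c : A) :
    ∃ f, HasFrequency s c f ∧ 0 ≤ f ∧ f ≤ 1 := by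
  let g : ℕ → ℝ := fun n => (window s 0 n).count c + 1
  have hsub : Subadditive g := by
    intro m n
    have := hs.count_le_succ (0 + m) 0 n c
    have h2 : (((window s (0 + m) n).count c : ℕ) : ℝ) ≤ (window s 0 n).count c + 1 := by
      exact_mod_cast this
    simp only [g, window_add, List.count_append]
    push_cast
    linarith
  have hbdd : BddBelow (Set.range fun n => g n / n) :=
    ⟨0, by rintro _ ⟨n, rfl⟩; simp only [g]; positivity⟩
  have hlim := (hsub.tendsto_lim hbdd).sub (tendsto_one_div_atTop_nhds_zero_nat (𝕜 := ℝ))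
  have hf : HasFrequency s c hsub.lim := by
    rw [sub_zero] at hlim
    refine hlim.congr fun n => ?_
    simp only [g]
    ring
  refine ⟨_, hf, ?_, ?_⟩
  · simpa using hf.le_mul (n := 1) (M := 0) fun i => Nat.zero_le _
  · simpa using hf.mul_le (n := 1) (M := 1) fun i => by
      simpa using List.count_le_length (a := c) (l := window s i 1)

theorem count_window_slide {s : ℕ → A} {c : A} {q i : ℕ}
    (h : (window s (i + 1) q).count c = (window s i q).count c) : s i = c ↔ s (i + q) = c := by
  have h1 : (window s i (q + 1)).count c = (window s (i + 1) q).count c + if s i = c then 1 else 0 := by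
    rw [window_succ, List.count_cons]; simp
  have h2 : (window s i (q + 1)).count c = (window s i q).count c + if s (i + q) = c then 1 else 0 := by
    rw [window_succ', List.count_append]; simp [List.count_singleton]
  by_cases ha : s i = c <;> by_cases hb : s (i + q) = c <;> simp_all

/-- For a rational frequency with denominator `q`, let `D i` be the deviation of the window of
length `q` at `i` from its mean. Sums of `D` along steps of `q` stay in `[-1, 1]`, and balance gives
all `D i` one sign. So each residue class mod `q` has at most one nonzero `D i`; beyond the last of
these, sliding the window shows that `s` has period `q`. -/
theorem IsSturmian.irrational {x y c : A} {s : ℕ → A} {f : ℝ} (hs : IsSturmian x y s)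
    (hc : c = x ∨ c = y) (hf : HasFrequency s c f) : Irrational f := by
  obtain ⟨hxy, hletters, hbal, hper⟩ := hs
  rintro ⟨r, rfl⟩
  apply hper
  set q := r.den
  have hq : 0 < q := r.den_pos
  let D : ℕ → ℤ := fun i => (window s i q).count c - r.num
  have hrq : (q : ℝ) * (r : ℝ) = r.num := by
    have := Rat.den_mul_eq_num r
    exact_mod_cast this
  have hsum (i k : ℕ) : ((window s i (k * q)).count c : ℤ) =
      k * r.num + ∑ j ∈ Finset.range k, D (i + j * q) := by
    induction k with
    | zero => simp
    | succ k ih =>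
      rw [Nat.succ_mul, window_add, List.count_append, Finset.sum_range_succ]
      push_cast
      rw [ih]
      simp only [D]
      ring
  have hle (i k : ℕ) : |∑ j ∈ Finset.range k, D (i + j * q)| ≤ 1 := by
    have h1 := hf.mul_le_count_add_one hbal i (k * q)
    have h2 := hf.count_le_mul_add_one hbal i (k * q)
    rw [Nat.cast_mul, mul_assoc, hrq] at h1 h2
    have h1' : (k : ℤ) * r.num ≤ (window s i (k * q)).count c + 1 := by exact_mod_cast h1
    have h2' : ((window s i (k * q)).count c : ℤ) ≤ k * r.num + 1 := by exact_mod_cast h2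
    rw [hsum i k] at h1' h2'
    rw [abs_le]
    omega
  have hsign : ∃ e : ℤ, |e| = 1 ∧ ∀ i, 0 ≤ e * D i := by
    by_cases h : ∃ i, D i < 0
    · obtain ⟨i, hi⟩ := h
      refine ⟨-1, by simp, fun j => ?_⟩
      have := hbal.count_le_succ j i q c
      simp only [D] at hi ⊢
      omega
    · push Not at h
      exact ⟨1, by simp, fun j => by simpa using h j⟩
  obtain ⟨e, he, hsgn⟩ := hsign
  have hinj : Set.InjOn (fun i => i % q) {i | D i ≠ 0} := by
    suffices H : ∀ i j, D i ≠ 0 → D j ≠ 0 → i < j → i % q ≠ j % q by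
      intro i hi j hj hij
      rcases lt_trichotomy i j with h | h | h
      · exact absurd hij (H i j hi hj h)
      · exact h
      · exact absurd hij.symm (H j i hj hi h)
    intro i j hi hj hij hmod
    obtain ⟨k, hk⟩ := (Nat.modEq_iff_dvd' hij.le).1 hmod
    have hj' : j = i + k * q := by rw [mul_comm]; omega
    have hk0 : 0 < k := by
      rcases Nat.eq_zero_or_pos k with rfl | h
      · omega
      · exact h
    have h1 := hle i (k + 1)
    have he0 : e ≠ 0 := by rintro rfl; simp at he
    have hpos : ∀ m, D m ≠ 0 → 1 ≤ e * D m := fun m hm =>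
      lt_of_le_of_ne (hsgn m) (mul_ne_zero he0 hm).symm
    have h2 : ∑ m ∈ ({0, k} : Finset ℕ), e * D (i + m * q) ≤
        ∑ m ∈ Finset.range (k + 1), e * D (i + m * q) := by
      apply Finset.sum_le_sum_of_subset_of_nonneg
      · intro m hm
        simp only [Finset.mem_insert, Finset.mem_singleton] at hm
        rw [Finset.mem_range]; omega
      · exact fun m _ _ => hsgn _
    rw [Finset.sum_pair hk0.ne, ← Finset.mul_sum, ← hj', zero_mul, add_zero] at h2
    have h3 : e * ∑ m ∈ Finset.range (k + 1), D (i + m * q) ≤ 1 := by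
      refine (le_abs_self _).trans ?_
      rw [abs_mul, he, one_mul]
      exact h1
    linarith [hpos i hi, hpos j hj]
  have hfin : {i | D i ≠ 0}.Finite :=
    Set.Finite.of_finite_image ((Set.finite_lt_nat q).subset
      (by rintro _ ⟨i, -, rfl⟩; exact Nat.mod_lt _ hq)) hinj
  obtain ⟨N, hN⟩ := hfin.bddAbove
  refine ⟨N + 1, q, hq, fun n hn => ?_⟩
  have hz : ∀ m, N < m → D m = 0 := fun m hm => by
    by_contra h
    exact absurd (hN h) (by omega)
  have hslide := count_window_slide (s := s) (c := c) (q := q) (i := n) (by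
    have h1 := hz n (by omega)
    have h2 := hz (n + 1) (by omega)
    simp only [D] at h1 h2
    omega)
  have h1 := hletters n
  have h2 := hletters (n + q)
  grind

end Windows

/-! ### Counting factors; the slope determines the language -/

section FactorCounts

variable {A : Type*}

theorem exists_append_cons_of_ne {l l' : List A} (hlen : l.length = l'.length) (hne : l ≠ l') :
    ∃ z c c' t t', c ≠ c' ∧ l = z ++ c :: t ∧ l' = z ++ c' :: t' := by
  induction l generalizing l' with
  | nil => exact absurd (List.length_eq_zero_iff.1 hlen.symm).symm hne
  | cons d l ih =>
    cases l' with
    | nil => simp at hlen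
    | cons d' l' =>
      by_cases hd : d = d'
      · subst hd
        obtain ⟨z, c, c', t, t', hc, h1, h2⟩ := ih (by simpa using hlen) (by simpa using hne)
        exact ⟨d :: z, c, c', t, t', hc, by simp [h1], by simp [h2]⟩
      · exact ⟨[], d, d', l, l', hd, rfl, rfl⟩

/-- A set of words over two letters that is closed under taking factors and balanced has at most
`n + 1` words of length `n`. -/
theorem finite_and_ncard_le_of_balanced [DecidableEq A] {X : Set (List A)} {x y : A} (hxy : x ≠ y)
    (htail : ∀ c l, c :: l ∈ X → l ∈ X) (hpre : ∀ l t, l ++ t ∈ X → l ∈ X)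
    (hlet : ∀ l ∈ X, ∀ c ∈ l, c = x ∨ c = y)
    (hbal : ∀ l ∈ X, ∀ l' ∈ X, l.length = l'.length → ∀ c, l.count c ≤ l'.count c + 1) (n : ℕ) :
    {l | l ∈ X ∧ l.length = n}.Finite ∧ {l | l ∈ X ∧ l.length = n}.ncard ≤ n + 1 := by
  induction n with
  | zero =>
    have h : {l | l ∈ X ∧ l.length = 0} ⊆ {[]} := by
      rintro l ⟨-, hl⟩
      simpa using hl
    exact ⟨(Set.finite_singleton _).subset h, by simpa using Set.ncard_le_ncard h⟩
  | succ n ih =>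
    obtain ⟨hfin, hcard⟩ := ih
    let S : A → Set (List A) := fun c => {l | c :: l ∈ X ∧ l.length = n}
    have hS (c : A) : S c ⊆ {l | l ∈ X ∧ l.length = n} := fun l hl => ⟨htail _ _ hl.1, hl.2⟩
    have hSf (c : A) : (S c).Finite := hfin.subset (hS c)
    have hsub : {l | l ∈ X ∧ l.length = n + 1} ⊆
        (List.cons x '' S x) ∪ (List.cons y '' S y) := by
      rintro l ⟨hl, hn⟩
      cases l with
      | nil => simp at hn
      | cons c l =>
        have hn' : l.length = n := by simpa using hn
        rcases hlet _ hl c (by simp) with rfl | rfl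
        · exact Or.inl ⟨l, ⟨hl, hn'⟩, rfl⟩
        · exact Or.inr ⟨l, ⟨hl, hn'⟩, rfl⟩
    -- At most one word of length `n` extends to the left by both letters: if two did, their first
    -- difference after a common prefix `z` would put `x z x` and `y z y` in `X`, against balance.
    have hinter : (S x ∩ S y).ncard ≤ 1 := by
      rw [Set.ncard_le_one ((hSf x).inter_of_left _)]
      rintro l ⟨⟨hlx, hl⟩, ⟨hly, -⟩⟩ l' ⟨⟨hlx', hl'⟩, ⟨hly', -⟩⟩
      by_contra hne
      obtain ⟨z, c, c', t, t', hc, h1, h2⟩ := exists_append_cons_of_ne (hl.trans hl'.symm) hne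
      have key : ∀ d e t t', d ≠ e → d :: (z ++ d :: t) ∈ X → e :: (z ++ e :: t') ∈ X → False := by
        intro d e t t' hde hd he
        have hd' : d :: (z ++ [d]) ∈ X := hpre _ t (by simpa using hd)
        have he' : e :: (z ++ [e]) ∈ X := hpre _ t' (by simpa using he)
        have := hbal _ hd' _ he' (by simp) d
        simp [List.count_append, hde.symm] at this
      have hcX := hlet _ hlx c (by simp [h1])
      have hcX' := hlet _ hlx' c' (by simp [h2])
      rw [h1] at hlx hly
      rw [h2] at hlx' hly'
      rcases hcX with rfl | rfl <;> rcases hcX' with rfl | rfl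
      · exact hc rfl
      · exact key _ _ _ _ hc hlx hly'
      · exact key _ _ _ _ hc hly hlx'
      · exact hc rfl
    have hfin' := ((hSf x).image (List.cons x)).union ((hSf y).image (List.cons y))
    refine ⟨hfin'.subset hsub, ?_⟩
    calc _ ≤ _ := Set.ncard_le_ncard hsub hfin'
      _ ≤ _ := Set.ncard_union_le _ _
      _ ≤ (S x).ncard + (S y).ncard :=
        add_le_add (Set.ncard_image_le (hSf x)) (Set.ncard_image_le (hSf y))
      _ = (S x ∪ S y).ncard + (S x ∩ S y).ncard :=
        (Set.ncard_union_add_ncard_inter _ _ (hSf x) (hSf y)).symm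
      _ ≤ (n + 1) + 1 := add_le_add
        ((Set.ncard_le_ncard (Set.union_subset (hS x) (hS y)) hfin).trans hcard) hinter

/-- The Morse–Hedlund theorem. -/
theorem succ_le_ncard_factors {s : ℕ → A} (hs : (Set.range s).Finite)
    (hper : ¬ IsEventuallyPeriodic s) (n : ℕ) : n + 1 ≤ (factors s n).ncard := by
  induction n with
  | zero =>
    rw [Nat.succ_le_iff, Set.ncard_pos (factors_finite s hs 0), factors_eq_range]
    exact Set.range_nonempty _
  | succ n ih =>
    refine Nat.succ_le_of_lt (lt_of_le_of_lt ih ?_)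
    by_contra! hle
    apply hper
    have htake (i : ℕ) : (window s i (n + 1)).take n = window s i n := by
      rw [window_succ']; simp
    have himage : List.take n '' factors s (n + 1) = factors s n := by
      rw [factors_eq_range, factors_eq_range, ← Set.range_comp]
      simp [Function.comp_def, htake]
    -- Without growth, truncation is injective, so a factor of length `n` determines the next
    -- letter; any repeated factor then forces a period.
    have hinj : Set.InjOn (List.take n) (factors s (n + 1)) := by
      apply Set.injOn_of_ncard_image_eq _ (factors_finite s hs _)
      apply le_antisymm (Set.ncard_image_le (factors_finite s hs _))
      rwa [himage]
    have hext {i j : ℕ} (h : window s i n = window s j n) :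
        window s i (n + 1) = window s j (n + 1) := by
      apply hinj
      · rw [factors_eq_range]; exact ⟨i, rfl⟩
      · rw [factors_eq_range]; exact ⟨j, rfl⟩
      · rw [htake, htake, h]
    have hnotinj : ¬ Function.Injective fun i => window s i n := by
      intro h
      have := factors_finite s hs n
      rw [factors_eq_range] at this
      exact Set.infinite_range_of_injective h this
    obtain ⟨i, j, hij, hlt⟩ : ∃ i j, window s i n = window s j n ∧ i < j := by
      simp only [Function.Injective] at hnotinj
      push Not at hnotinj
      obtain ⟨i, j, h, hne⟩ := hnotinj
      rcases lt_or_gt_of_ne hne with hlt | hlt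
      · exact ⟨i, j, h, hlt⟩
      · exact ⟨j, i, h.symm, hlt⟩
    have hall (k : ℕ) : window s (i + k) n = window s (j + k) n := by
      induction k with
      | zero => exact hij
      | succ k ihk =>
        have := hext ihk
        rw [window_succ, window_succ] at this
        exact (List.cons.inj this).2
    refine ⟨i + n, j - i, by omega, fun m hm => ?_⟩
    have := hext (hall (m - i - n))
    rw [window_succ', window_succ'] at this
    have h2 := (List.append_inj' this rfl).2
    rw [List.cons.injEq] at h2
    convert h2.1.symm using 2 <;> omega

variable [DecidableEq A]

theorem IsSturmian.finite_range {x y : A} {s : ℕ → A} (hs : IsSturmian x y s) :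
    (Set.range s).Finite :=
  (Set.toFinite {x, y}).subset (by rintro _ ⟨n, rfl⟩; exact hs.2.1 n)

theorem IsSturmian.mem_of_mem_language {x y : A} {s : ℕ → A} (hs : IsSturmian x y s) {l : List A}
    (hl : l ∈ language s) {c : A} (hc : c ∈ l) : c = x ∨ c = y := by
  obtain ⟨i, n, rfl⟩ := mem_language_iff.1 hl
  obtain ⟨k, -, rfl⟩ := mem_window_iff.1 hc
  exact hs.2.1 _

theorem IsBalanced.count_le_succ_of_mem {s : ℕ → A} (hs : IsBalanced 1 s) {l l' : List A}
    (hl : l ∈ language s) (hl' : l' ∈ language s) (h : l.length = l'.length) (c : A) :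
    l.count c ≤ l'.count c + 1 := by
  have := (abs_le.1 (hs l hl l' hl' h c)).2
  push_cast at this
  omega

theorem IsSturmian.ncard_factors_le {x y : A} {s : ℕ → A} (hs : IsSturmian x y s) (n : ℕ) :
    (factors s n).ncard ≤ n + 1 :=
  (finite_and_ncard_le_of_balanced hs.1 (fun _ _ => language_tail) (fun _ _ => language_of_append)
    (fun _ hl _ => hs.mem_of_mem_language hl)
    (fun _ hl _ hl' => hs.2.2.1.count_le_succ_of_mem hl hl') n).2

theorem IsSturmian.count_add_count {x y : A} {s : ℕ → A} (hs : IsSturmian x y s) {l : List A}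
    (hl : l ∈ language s) : l.count x + l.count y = l.length := by
  have : ∀ c ∈ l, c = x ∨ c = y := fun c => hs.mem_of_mem_language hl
  have hxy := hs.1
  clear hl hs
  induction l with
  | nil => simp
  | cons d l ih =>
    have := ih fun c hc => this c (List.mem_cons_of_mem _ hc)
    rcases ‹∀ c ∈ d :: l, c = x ∨ c = y› d (by simp) with rfl | rfl
    · simp [hxy]; omega
    · simp [hxy.symm]; omega

/-- Sturmian sequences with the same slope have the same factors. -/
theorem IsSturmian.language_subset {x y : A} {s t : ℕ → A} (hs : IsSturmian x y s)
    (ht : IsSturmian x y t) {f : ℝ} (hf0 : 0 < f) (hirr : Irrational f) (hfs : HasFrequency s y f)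
    (hft : HasFrequency t y f) : language s ⊆ language t := by
  intro l hl
  have hy : ∀ r, r = s ∨ r = t → ∀ l ∈ language r, 1 ≤ l.length →
      l.count y = ⌊l.length * f⌋₊ ∨ l.count y = ⌊l.length * f⌋₊ + 1 := by
    rintro r (rfl | rfl) l hl h1 <;> obtain ⟨i, n, rfl⟩ := mem_language_iff.1 hl <;>
      rw [window_length] at h1 ⊢
    · exact hfs.count_eq_floor hs.2.2.1 hirr hf0 h1 i
    · exact hft.count_eq_floor ht.2.2.1 hirr hf0 h1 i
  -- The union of the languages is still balanced, since both sequences have the same two possible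
  -- counts of `y`. It thus has at most `n + 1` words of length `n`, and `t` alone already supplies
  -- that many.
  have hX := finite_and_ncard_le_of_balanced (X := language s ∪ language t) hs.1
    (fun _ _ h => h.imp language_tail language_tail)
    (fun _ _ h => h.imp language_of_append language_of_append)
    (fun _ h _ hc => h.elim (fun h => hs.mem_of_mem_language h hc)
      (fun h => ht.mem_of_mem_language h hc)) (by
      have hy' : ∀ l ∈ language s ∪ language t, 1 ≤ l.length →
          l.count y = ⌊l.length * f⌋₊ ∨ l.count y = ⌊l.length * f⌋₊ + 1 := by
        rintro l (h | h)
        · exact hy s (Or.inl rfl) l h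
        · exact hy t (Or.inr rfl) l h
      have hsum : ∀ l ∈ language s ∪ language t, l.count x + l.count y = l.length := by
        rintro l (h | h)
        · exact hs.count_add_count h
        · exact ht.count_add_count h
      have hmem : ∀ l ∈ language s ∪ language t, ∀ c ∈ l, c = x ∨ c = y := by
        rintro l (h | h) c hc
        · exact hs.mem_of_mem_language h hc
        · exact ht.mem_of_mem_language h hc
      intro l hl l' hl' hlen c
      by_cases hc : c ∈ l
      swap
      · simp [List.count_eq_zero.2 hc]
      have h1 := hy' l hl (List.length_pos_of_mem hc)
      have h2 := hy' l' hl' (hlen ▸ List.length_pos_of_mem hc)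
      have h3 := hsum l hl
      have h4 := hsum l' hl'
      rw [← hlen] at h2 h4
      rcases hmem l hl c hc with rfl | rfl <;> omega) l.length
  have hsub : factors t l.length ⊆ {w | w ∈ language s ∪ language t ∧ w.length = l.length} :=
    fun w hw => ⟨Or.inr hw.1, hw.2⟩
  have heq := Set.eq_of_subset_of_ncard_le hsub
    (hX.2.trans (succ_le_ncard_factors ht.finite_range ht.2.2.2 _)) hX.1
  have : l ∈ factors t l.length := by
    rw [heq]
    exact ⟨Or.inl hl, rfl⟩
  exact this.1

end FactorCounts

/-! ### Colourings: balance and complexities -/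

section Colouring

variable {A : Type*}

/-- The word obtained from `l` by replacing every `a` with `e` and the `b`'s with the letters
of `y`. -/
def paint (e : A) : List AB → List A → List A
  | [], _ => []
  | AB.a :: l, y => e :: paint e l y
  | AB.b :: _, [] => []
  | AB.b :: l, c :: y => c :: paint e l y

theorem window_colour (u : ℕ → AB) (e : A) (b : ℕ → A) (i n : ℕ) :
    window (colour u (fun _ => e) b) i n = paint e (window u i n)
      (window b ((window u 0 i).count AB.b) ((window u i n).count AB.b)) := by
  induction n generalizing i with
  | zero => rfl
  | succ n ih =>
    rw [window_succ, window_succ, ih, window_succ' u 0 i, List.count_append, zero_add]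
    cases h : u i with
    | a => simp [paint, colour, h]
    | b => simp [paint, colour, h, window_succ]

theorem count_paint [DecidableEq A] (e c : A) (l : List AB) (y : List A)
    (h : y.length = l.count AB.b) :
    (paint e l y).count c = (if e = c then l.count AB.a else 0) + y.count c := by
  induction l generalizing y with
  | nil => simp_all [paint]
  | cons d l ih =>
    cases d with
    | a =>
      have := ih y (by simpa using h)
      simp only [paint, List.count_cons, this]
      by_cases hc : e = c <;> simp [hc]; omega
    | b =>
      cases y with
      | nil => simp at h
      | cons d y =>
        have := ih y (by simpa using h)
        simp only [paint, List.count_cons, this]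
        simp [add_assoc]

variable [DecidableEq A] {u : ℕ → AB} {e : A} {b : ℕ → A}

theorem count_window_colour (u : ℕ → AB) (e : A) (b : ℕ → A) (i n : ℕ) (c : A) :
    (window (colour u (fun _ => e) b) i n).count c =
      (if e = c then (window u i n).count AB.a else 0) +
      (window b ((window u 0 i).count AB.b) ((window u i n).count AB.b)).count c := by
  rw [window_colour, count_paint _ _ _ _ (by simp)]

/-- One unit of imbalance comes from `b`, and one from the two factors of `u` differing by at most
one in their number of `b`'s. -/
theorem isBalanced_two_colour (hu : IsSturmian AB.a AB.b u) (hb : IsBalanced 1 b)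
    (he : ∀ n, b n ≠ e) : IsBalanced 2 (colour u (fun _ => e) b) := by
  rw [isBalanced_iff]
  intro i j n c
  rw [count_window_colour, count_window_colour]
  by_cases hc : e = c
  · subst hc
    have hz : ∀ i n, (window b i n).count e = 0 := by
      intro i n
      rw [List.count_eq_zero, mem_window_iff]
      rintro ⟨k, -, hk⟩
      exact he _ hk
    have := isBalanced_iff.1 hu.2.2.1 i j n AB.a
    simp only [hz, if_true]
    rw [abs_le] at this ⊢
    push_cast at *
    omega
  · simp only [hc, if_false, zero_add]
    have key : ∀ i j k m, k ≤ m → m ≤ k + 1 →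
        |((window b i k).count c : ℤ) - (window b j m).count c| ≤ 2 := by
      intro i j k m h1 h2
      have h3 := hb.count_le_succ i j k c
      have h4 := hb.count_le_succ j i k c
      rw [abs_le]
      obtain rfl | rfl : m = k ∨ m = k + 1 := by omega
      · omega
      · have h5 : (window b j (k + 1)).count c =
            (window b j k).count c + [b (j + k)].count c := by
          rw [window_succ', List.count_append]
        have h6 : [b (j + k)].count c ≤ 1 := List.count_le_length
        omega
    have h1 := hu.2.2.1.count_le_succ i j n AB.b
    have h2 := hu.2.2.1.count_le_succ j i n AB.b
    rcases le_total ((window u i n).count AB.b) ((window u j n).count AB.b) with h | h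
    · exact_mod_cast key _ _ _ _ h h2
    · rw [abs_sub_comm]
      exact_mod_cast key _ _ _ _ h h1

theorem abelianComplexity_colour_le {x y : A} (hu : IsSturmian AB.a AB.b u)
    (hb : IsSturmian x y b) (n : ℕ) :
    abelianComplexity (colour u (fun _ => e) b) n ≤ 4 := by
  obtain ⟨K, hK⟩ := hu.2.2.1.exists_count_eq n AB.b
  obtain ⟨M, hM⟩ := hb.2.2.1.exists_count_eq K y
  obtain ⟨M', hM'⟩ := hb.2.2.1.exists_count_eq (K + 1) y
  -- The Parikh vector is recovered from the number of `b`'s in the factor of `u` and the number of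
  -- `y`'s among their colours. The two summands are added because `e` may coincide with `x` or `y`.
  let g : ℕ × ℕ → A → ℕ := fun p c => (if e = c then n - p.1 else 0) +
    if c = y then p.2 else if c = x then p.1 - p.2 else 0
  let T : Finset (ℕ × ℕ) := {(K, M), (K, M + 1), (K + 1, M'), (K + 1, M' + 1)}
  have hsub : parikh '' factors (colour u (fun _ => e) b) n ⊆ g '' T := by
    rw [factors_eq_range]
    rintro _ ⟨_, ⟨i, rfl⟩, rfl⟩
    set j := (window u 0 i).count AB.b
    set k := (window u i n).count AB.b with hk
    refine ⟨(k, (window b j k).count y), ?_, ?_⟩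
    · have h1 := hM j
      have h2 := hM' j
      rcases hK i with h | h <;> rw [← hk] at h <;> rw [h] <;> simp [T] <;> omega
    · funext c
      have h1 := hu.count_add_count (window_mem_language u i n)
      have h2 := hb.count_add_count (window_mem_language b j k)
      rw [window_length] at h1 h2
      simp only [parikh, g]
      rw [count_window_colour]
      congr 1
      · split_ifs <;> omega
      · split_ifs with h3 h4
        · rw [h3]
        · rw [h4]
          change _ = (window b j k).count x
          omega
        · symm
          rw [List.count_eq_zero]
          intro h
          have := hb.mem_of_mem_language (window_mem_language b j k) h
          tauto
  calc _ ≤ (g '' (T : Set (ℕ × ℕ))).ncard := Set.ncard_le_ncard hsub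
    _ ≤ (T : Set (ℕ × ℕ)).ncard := Set.ncard_image_le
    _ = T.card := Set.ncard_coe_finset T
    _ ≤ 4 := Finset.card_le_four

theorem factorComplexity_colour_le {x y : A} {w : ℕ → AB} {α : ℝ} (hu : IsSturmian AB.a AB.b u)
    (hα : HasFrequency u AB.b α) (hirr : Irrational α) (hα0 : 0 < α) (hα1 : α < 1)
    (hb : IsSturmian x y b) (hw : IsSturmian AB.a AB.b w) (hwα : HasFrequency w AB.b α)
    {n : ℕ} (hn : 1 ≤ n) :
    factorComplexity (colour u (fun _ => e) b) n ≤
      parikhCount w α n + (n + 1) * ⌈(n : ℝ) * α⌉₊ := by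
  have hfin := factors_finite u hu.finite_range n
  set F := hfin.toFinset
  set K := ⌊(n : ℝ) * α⌋₊
  have hpos : 0 < (n : ℝ) * α := by positivity
  have hceil : ⌈(n : ℝ) * α⌉₊ = K + 1 := by
    apply le_antisymm (Nat.ceil_le_floor_add_one _)
    rw [Nat.succ_le_iff, Nat.lt_ceil]
    exact lt_of_le_of_ne (Nat.floor_le hpos.le) fun h => (hirr.natCast_mul (by omega)).ne_nat _ h.symm
  have hKn : K + 1 ≤ n := by
    rw [← hceil, Nat.ceil_le]
    have : (0 : ℝ) < n := by positivity
    nlinarith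
  have hfloor : ⌊(1 - α) * (n : ℝ)⌋₊ = n - (K + 1) := by
    have h1 := Nat.le_ceil ((n : ℝ) * α)
    have h2 := Nat.floor_le hpos.le
    have h3 : (⌊(n : ℝ) * α⌋₊ : ℝ) ≠ n * α :=
      fun h => (hirr.natCast_mul (by omega)).ne_nat _ h.symm
    have h4 := lt_of_le_of_ne h2 h3
    rw [hceil] at h1
    push_cast at h1
    rw [Nat.floor_eq_iff (by nlinarith), Nat.cast_sub hKn]
    push_cast
    constructor <;> linarith
  -- Each factor of `u` is charged `K + 1` colourings, with one more exactly for those having `K +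
  -- 1` letters `b`.
  have hcount : ∀ l ∈ F, l.count AB.b ≤ K + if l.count AB.b = K + 1 then 1 else 0 := by
    intro l hl
    rw [hfin.mem_toFinset, factors_eq_range] at hl
    obtain ⟨i, rfl⟩ := hl
    rcases hα.count_eq_floor hu.2.2.1 hirr hα0 hn i with h | h
    · simp [h, K]
    · simp [h, K]
  have hsub : factors (colour u (fun _ => e) b) n ⊆
      ⋃ l ∈ F, paint e l '' factors b (l.count AB.b) := by
    rw [factors_eq_range]
    rintro _ ⟨i, rfl⟩
    rw [Set.mem_iUnion₂]
    refine ⟨window u i n, ?_, ?_⟩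
    · rw [hfin.mem_toFinset, factors_eq_range]
      exact ⟨i, rfl⟩
    · simp only [window_colour, factors_eq_range]
      exact ⟨_, ⟨_, rfl⟩, rfl⟩
  have hbf := factors_finite b hb.finite_range
  have hfinU : (⋃ l ∈ F, paint e l '' factors b (l.count AB.b)).Finite :=
    F.finite_toSet.biUnion fun l _ => (hbf _).image _
  have hfilter : (F.filter fun l => l.count AB.b = K + 1).card ≤ parikhCount w α n := by
    rw [← Set.ncard_coe_finset, parikhCount]
    apply Set.ncard_le_ncard
    · intro l hl
      rw [Finset.mem_coe, Finset.mem_filter, hfin.mem_toFinset] at hl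
      obtain ⟨⟨hl, hlen⟩, hlb⟩ := hl
      have := hu.count_add_count hl
      refine ⟨hu.language_subset hw hα0 hirr hα hwα hl, ?_, ?_⟩
      · rw [hfloor, parikh]; omega
      · rw [hceil, parikh]; omega
    · refine (factors_finite w hw.finite_range n).subset ?_
      rintro l ⟨hl, h1, h2⟩
      refine ⟨hl, ?_⟩
      have := hw.count_add_count hl
      rw [hfloor, parikh] at h1
      rw [hceil, parikh] at h2
      omega
  have hFcard : F.card ≤ n + 1 := by
    rw [← Set.ncard_eq_toFinset_card _ hfin]
    exact hu.ncard_factors_le n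
  calc _ ≤ _ := Set.ncard_le_ncard hsub hfinU
    _ ≤ ∑ l ∈ F, (paint e l '' factors b (l.count AB.b)).ncard := Finset.set_ncard_biUnion_le _ _
    _ ≤ ∑ l ∈ F, ((K + 1) + if l.count AB.b = K + 1 then 1 else 0) := by
      refine Finset.sum_le_sum fun l hl => ?_
      have h1 := (Set.ncard_image_le (hbf (l.count AB.b)) (f := paint e l)).trans
        (hb.ncard_factors_le _)
      have h2 := hcount l hl
      omega
    _ = F.card * (K + 1) + (F.filter fun l => l.count AB.b = K + 1).card := by
      rw [Finset.sum_add_distrib, Finset.sum_const, smul_eq_mul, Finset.card_filter]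
    _ ≤ (n + 1) * (K + 1) + parikhCount w α n :=
      add_le_add (Nat.mul_le_mul_right _ hFcard) hfilter
    _ = _ := by rw [hceil, add_comm]

end Colouring

/-! ### Balanced sequences over three letters -/

section ThreeLetters

variable {A : Type*}

/-- `P` marks the starts of blocks: each block spells `pat` and ends where another begins. -/
theorem isEventuallyPeriodic_of_block {s : ℕ → A} {m p₀ : ℕ} (hm : 0 < m) (P : ℕ → Prop)
    (pat : ℕ → A) (h₀ : P p₀) (h : ∀ p, P p → P (p + m) ∧ ∀ t < m, s (p + t) = pat t) :
    IsEventuallyPeriodic s := by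
  have hP (k : ℕ) : P (p₀ + m * k) := by
    induction k with
    | zero => exact h₀
    | succ k ih => rw [Nat.mul_succ, ← add_assoc]; exact (h _ ih).1
  have hs (n : ℕ) (hn : p₀ ≤ n) : s n = pat ((n - p₀) % m) := by
    rw [← (h _ (hP ((n - p₀) / m))).2 _ (Nat.mod_lt _ hm)]
    congr 1
    have := Nat.div_add_mod (n - p₀) m
    omega
  refine ⟨p₀, m, hm, fun n hn => ?_⟩
  rw [hs n hn, hs (n + m) (by omega), show n + m - p₀ = n - p₀ + m by omega, Nat.add_mod_right]

variable [DecidableEq A]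

theorem HasFrequency.le_of_count_le {s : ℕ → A} {c d : A} {f g : ℝ} (hf : HasFrequency s c f)
    (hg : HasFrequency s d g) (C : ℕ)
    (h : ∀ n, (window s 0 n).count c ≤ (window s 0 n).count d + C) : f ≤ g := by
  have hlim := hg.add (tendsto_const_div_atTop_nhds_zero_nat (C : ℝ))
  rw [add_zero] at hlim
  refine le_of_tendsto_of_tendsto' hf hlim fun n => ?_
  rw [← add_div]
  gcongr
  exact_mod_cast h n

theorem HasFrequency.exists_ge {s : ℕ → A} {c : A} {f : ℝ} (hf : HasFrequency s c f)
    (hf0 : 0 < f) (N : ℕ) : ∃ p, N ≤ p ∧ s p = c := by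
  by_contra! h
  refine hf0.not_ge (le_of_tendsto_of_tendsto' hf
    (tendsto_const_div_atTop_nhds_zero_nat (N : ℝ)) fun n => ?_)
  gcongr
  rcases le_total n N with hn | hn
  · exact (List.count_le_length.trans (by simp)).trans hn
  · obtain ⟨m, rfl⟩ := Nat.exists_eq_add_of_le hn
    rw [window_add, List.count_append, zero_add, List.count_eq_zero_of_not_mem (l := window s N m)]
    · exact List.count_le_length.trans (by simp)
    · rw [mem_window_iff]
      rintro ⟨k, -, hk⟩
      exact h _ (by omega) hk

/-- If `c` is more frequent than `d`, there are two consecutive occurrences of `c` without `d` in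
between. -/
theorem HasFrequency.exists_gap {s : ℕ → A} {c d : A} {f g : ℝ} (hf : HasFrequency s c f)
    (hg : HasFrequency s d g) (hgf : g < f) :
    ∃ i k, s i = c ∧ s (i + k + 1) = c ∧ ∀ t < k, s (i + 1 + t) ≠ c ∧ s (i + 1 + t) ≠ d := by
  by_contra! hno
  have hcd : c ≠ d := by
    rintro rfl
    exact hgf.ne (tendsto_nhds_unique hg hf)
  refine hgf.not_ge (hf.le_of_count_le hg 1 fun n => ?_)
  -- If a `d` separates any two consecutive `c`'s, then `c` leads by at most 1. The induction also
  -- records that, when it leads, the last letter among `c` and `d` is a `c`.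
  suffices H : (window s 0 n).count c ≤ (window s 0 n).count d + 1 ∧
      ((window s 0 n).count c = (window s 0 n).count d + 1 →
        ∃ i < n, s i = c ∧ ∀ t, i < t → t < n → s t ≠ c ∧ s t ≠ d) from H.1
  induction n with
  | zero => simp
  | succ n ih =>
    obtain ⟨h1, h2⟩ := ih
    rw [window_succ', List.count_append, List.count_append, zero_add, List.count_singleton,
      List.count_singleton]
    by_cases hc : s n = c
    · have hlt : (window s 0 n).count c ≠ (window s 0 n).count d + 1 := by
        intro heq
        obtain ⟨i, hi, hic, hbetween⟩ := h2 heq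
        obtain ⟨t, ht, ht'⟩ := hno i (n - i - 1) hic (by rw [← hc]; congr 1; omega)
        have := hbetween (i + 1 + t) (by omega) (by omega)
        exact this.2 (ht' this.1)
      simp only [hc, hcd, beq_self_eq_true, if_true, beq_iff_eq, if_false]
      exact ⟨by omega, fun _ => ⟨n, by omega, hc, fun t _ _ => by omega⟩⟩
    · by_cases hd : s n = d
      · simp only [hd, hcd.symm, beq_self_eq_true, if_true, beq_iff_eq, if_false]
        exact ⟨by omega, fun h => by omega⟩
      · simp only [hc, hd, beq_iff_eq, if_false]
        refine ⟨h1, fun h => ?_⟩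
        obtain ⟨i, hi, hic, hbetween⟩ := h2 h
        refine ⟨i, by omega, hic, fun t ht ht' => ?_⟩
        rcases Nat.lt_succ_iff_lt_or_eq.1 ht' with h | rfl
        · exact hbetween t ht h
        · exact ⟨hc, hd⟩

/-- A factor `c c` would force a `c` into every window of length 2, hence a frequency of at least
1/2. -/
theorem IsBalanced.ne_succ_of_frequency {s : ℕ → A} {c : A} {f : ℝ} (hs : IsBalanced 1 s)
    (hf : HasFrequency s c f) (hf2 : f < 1 / 2) (i : ℕ) (hi : s i = c) : s (i + 1) ≠ c := by
  intro hi'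
  have h1 := hf.le_mul (n := 2) (M := 1) fun j => by
    have := hs.count_le_succ i j 2 c
    simp only [window_succ, window_zero, hi, hi', List.count_cons_self, List.count_nil] at this ⊢
    omega
  push_cast at h1
  linarith

/-- A balanced sequence over three letters with distinct frequencies is eventually periodic. -/
theorem IsBalanced.isEventuallyPeriodic {s : ℕ → A} {x y z : A} {fx fy fz : ℝ}
    (hs : IsBalanced 1 s) (hxy : x ≠ y) (hxz : x ≠ z) (hyz : y ≠ z)
    (hlet : ∀ n, s n = x ∨ s n = y ∨ s n = z) (hx : HasFrequency s x fx)
    (hy : HasFrequency s y fy) (hz : HasFrequency s z fz) (hz0 : 0 < fz) (hzy : fz < fy)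
    (hyx : fy < fx) (hsum : fx + fy + fz = 1) : IsEventuallyPeriodic s := by
  have hyy := hs.ne_succ_of_frequency hy (by linarith)
  have hzz := hs.ne_succ_of_frequency hz (by linarith)
  have hwin3 : ∀ i, window s i 3 = [s i, s (i + 1), s (i + 2)] := fun i => rfl
  have hwin4 : ∀ i, window s i 4 = [s i, s (i + 1), s (i + 2), s (i + 3)] := fun i => rfl
  have hwin5 : ∀ i, window s i 5 = [s i, s (i + 1), s (i + 2), s (i + 3), s (i + 4)] :=
    fun i => rfl
  obtain ⟨i₀, k₀, hi₀, hi₀', hbet₀⟩ := hy.exists_gap hz hzy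
  replace hbet₀ : ∀ t < k₀, s (i₀ + 1 + t) = x := fun t ht => by
    have h1 := hbet₀ t ht
    have h2 := hlet (i₀ + 1 + t)
    tauto
  -- a factor `x z x` excludes the factor `y x y`
  have hyxy : ∀ j i, s j = x → s (j + 1) = z → s (j + 2) = x → s i = y → s (i + 2) ≠ y := by
    intro j i h1 h2 h3 h4 h5
    have := hs.count_le_succ i j 3 y
    rw [hwin3, hwin3, h1, h2, h3, h4, h5] at this
    simp [List.count_cons, hxy, hyz.symm] at this
  -- The factor `x x` occurs: some gap between `x`'s consists of `z`'s only and has length 0 or 1.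
  -- Length 1 gives `x z x`, which excludes `y x y`, so the gap of `x`'s between two `y`'s found
  -- above has length at least 2.
  obtain ⟨q, hq, hq'⟩ : ∃ q, s q = x ∧ s (q + 1) = x := by
    obtain ⟨j, l, hj, hj', hbet⟩ := hx.exists_gap hy hyx
    replace hbet : ∀ t < l, s (j + 1 + t) = z := fun t ht => by
      have h1 := hbet t ht
      have h2 := hlet (j + 1 + t)
      tauto
    obtain rfl | rfl | hl : l = 0 ∨ l = 1 ∨ 2 ≤ l := by omega
    · exact ⟨j, hj, hj'⟩
    · obtain rfl | rfl | hk : k₀ = 0 ∨ k₀ = 1 ∨ 2 ≤ k₀ := by omega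
      · exact absurd hi₀' (hyy _ hi₀)
      · exact absurd hi₀' (hyxy j i₀ hj (hbet 0 (by omega)) hj' hi₀)
      · exact ⟨i₀ + 1, hbet₀ 0 (by omega), hbet₀ 1 (by omega)⟩
    · exact absurd (hbet 1 (by omega)) (hzz _ (hbet 0 (by omega)))
  have hx2 : ∀ i, s i = x ∨ s (i + 1) = x := by
    intro i
    have := hs.count_le_succ q i 2 x
    by_contra! h
    simp [window_succ, hq, hq', h.1, h.2] at this
  have hnbr : ∀ p, s (p + 1) = z → s p = x ∧ s (p + 2) = x := fun p hp => by
    have h1 := hx2 p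
    have h2 := hx2 (p + 1)
    grind
  obtain ⟨p₁, -, hp₁⟩ : ∃ p, 0 ≤ p ∧ s (p + 1) = z := by
    obtain ⟨p, hp, hpz⟩ := hz.exists_ge hz0 1
    exact ⟨p - 1, Nat.zero_le _, by rwa [Nat.sub_add_cancel hp]⟩
  have hyxy' : ∀ i, s i = y → s (i + 2) ≠ y := fun i =>
    hyxy p₁ i (hnbr p₁ hp₁).1 hp₁ (hnbr p₁ hp₁).2
  -- two occurrences of `y` with only `x` in between are three places apart
  have hgap : ∀ i k, s i = y → s (i + k + 1) = y → (∀ t < k, s (i + 1 + t) = x) → k = 2 := by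
    intro i k hi hi' hbet
    by_contra hk2
    obtain rfl | rfl | hk : k = 0 ∨ k = 1 ∨ 3 ≤ k := by omega
    · exact hyy _ hi hi'
    · exact hyxy' _ hi hi'
    -- For `k ≥ 3`, the run `x^k` leaves at most one other letter in any window of length `k`. So a
    -- `z` has `k - 1` letters `x` on each side, which gives a window of length `k + 2` without `y`,
    -- against the two `y`'s of `y x^k y`.
    have hkx : ∀ j, k ≤ (window s j k).count x + 1 := by
      intro j
      have h1 := hs.count_le_succ (i + 1) j k x
      have h2 : (window s (i + 1) k).count x = k := by
        rw [List.count_eq_length.2, window_length]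
        intro c hc
        obtain ⟨t, ht, rfl⟩ := mem_window_iff.1 hc
        exact (hbet t ht).symm
      omega
    obtain ⟨p, hp, hpz⟩ := hz.exists_ge hz0 k
    have hall : ∀ j, k - 1 ≤ (window s j (k - 1)).count x → ∀ t < k - 1, s (j + t) = x := by
      intro j hj t ht
      have := List.count_eq_length.1 (le_antisymm List.count_le_length (by rw [window_length]; exact hj))
      exact (this _ (mem_window_iff.2 ⟨t, ht, rfl⟩)).symm
    obtain ⟨m, rfl⟩ : ∃ m, k = m + 1 := ⟨k - 1, by omega⟩
    rw [Nat.add_sub_cancel] at hall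
    have hright := hall (p + 1) (by
      have := hkx p
      rw [window_succ, List.count_cons, hpz] at this
      simp [hxz.symm] at this
      omega)
    have hleft := hall (p - m) (by
      have := hkx (p - m)
      rw [window_succ', List.count_append, show p - m + m = p by omega, hpz] at this
      simp [hxz.symm] at this
      omega)
    have h1 := hs.count_le_succ i (p - m) (m + 3) y
    have h2 : (window s (p - m) (m + 3)).count y = 0 := by
      rw [List.count_eq_zero, mem_window_iff]
      rintro ⟨t, ht, hty⟩
      rcases lt_trichotomy t m with h | rfl | h
      · exact hxy ((hleft t h).symm.trans hty)
      · rw [show p - t + t = p by omega, hpz] at hty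
        exact hyz hty.symm
      · have := hright (t - m - 1) (by omega)
        rw [show p + 1 + (t - m - 1) = p - m + t by omega] at this
        exact hxy (this.symm.trans hty)
    have h3 : 2 ≤ (window s i (m + 3)).count y := by
      rw [window_succ, window_succ', List.count_cons, List.count_append,
        show i + 1 + (m + 1) = i + (m + 1) + 1 by omega, hi, hi']
      simp
    omega
  obtain rfl := hgap i₀ k₀ hi₀ hi₀' hbet₀
  have hx₁ := hbet₀ 0 (by omega)
  have hx₂ := hbet₀ 1 (by omega)
  -- The factor `y x x y` has two `y`'s, so every window of length 4 has at least one.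
  have hy4 : ∀ i, s i = y ∨ s (i + 1) = y ∨ s (i + 2) = y ∨ s (i + 3) = y := by
    intro i
    have := hs.count_le_succ i₀ i 4 y
    by_contra! h
    rw [hwin4, hwin4] at this
    simp [List.count_cons, hi₀, hi₀', h] at this
  have hxxx : ∀ i, s (i + 1) = x → s (i + 2) = x → s (i + 3) ≠ x := by
    intro i h1 h2 h3
    have h4 : s i = y := by have := hy4 i; grind
    have h5 : s (i + 4) = y := by have := hy4 (i + 1); grind
    have := hgap i 3 h4 h5 fun t ht => by interval_cases t <;> assumption
    omega
  have haround : ∀ p, s (p + 2) = z →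
      s p = y ∧ s (p + 1) = x ∧ s (p + 3) = x ∧ s (p + 4) = y := by
    intro p hp
    have h1 := hnbr (p + 1) hp
    have h2 := hy4 p
    have h3 := hy4 (p + 1)
    grind
  obtain ⟨p₀, hp₀⟩ : ∃ p, s (p + 2) = z := by
    obtain ⟨p, hp, hpz⟩ := hz.exists_ge hz0 2
    exact ⟨p - 2, by rwa [Nat.sub_add_cancel hp]⟩
  have hxxyxx : ∀ i, s i = x → s (i + 1) = x → s (i + 2) = y → s (i + 3) = x →
      s (i + 4) ≠ x := by
    intro i h0 h1 h2 h3 h4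
    have := hs.count_le_succ i p₀ 5 x
    obtain ⟨g0, g1, g3, g4⟩ := haround p₀ hp₀
    rw [hwin5, hwin5, h0, h1, h2, h3, h4, g0, g1, hp₀, g3, g4] at this
    simp [hxy.symm, hxz.symm] at this
  -- From one `z` to the next the sequence reads `z x y x` or `z x y x x y x`.
  have hnext : ∀ p, s (p + 2) = z → s (p + 5) = x ∧ (s (p + 6) = z ∨
      (s (p + 6) = x ∧ s (p + 7) = y ∧ s (p + 8) = x ∧ s (p + 9) = z)) := by
    intro p hp
    obtain ⟨-, -, g3, g4⟩ := haround p hp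
    have h5 : s (p + 5) = x := by have := hx2 (p + 4); grind
    refine ⟨h5, ?_⟩
    rcases hlet (p + 6) with h6 | h6 | h6
    · right
      have h7 : s (p + 7) = y := by
        rcases hlet (p + 7) with h | h | h
        · exact absurd h (hxxx (p + 4) h5 h6)
        · exact h
        · have := (haround (p + 5) h).1
          grind
      have h8 : s (p + 8) = x := by have := hx2 (p + 7); grind
      refine ⟨h6, h7, h8, ?_⟩
      rcases hlet (p + 9) with h | h | h
      · exact absurd h (hxxyxx (p + 5) h5 h6 h7 h8)
      · exact absurd h (hyxy' (p + 7) h7)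
      · exact h
    · exact absurd h6 (hyxy' (p + 4) g4)
    · exact Or.inl h6
  -- The two return words cannot both occur: `z x y x z` has two `z`'s, while `x y x x y`, inside
  -- the longer one, has none.
  have hmix : ∀ i j, s i = z → s (i + 1) = x → s (i + 2) = y → s (i + 3) = x → s (i + 4) = z →
      s j = x → s (j + 1) = y → s (j + 2) = x → s (j + 3) = x → s (j + 4) ≠ y := by
    intro i j h0 h1 h2 h3 h4 g0 g1 g2 g3 g4
    have := hs.count_le_succ i j 5 z
    rw [hwin5, hwin5, h0, h1, h2, h3, h4, g0, g1, g2, g3, g4] at this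
    simp [hxz, hyz] at this
  by_cases hshort : ∃ p, s (p + 2) = z ∧ s (p + 6) = z
  · obtain ⟨p, hp, hp'⟩ := hshort
    refine isEventuallyPeriodic_of_block (m := 4) (p₀ := p + 2) (by omega)
      (fun p => 2 ≤ p ∧ s p = z) (fun t => if t = 0 then z else if t = 2 then y else x)
      ⟨by omega, hp⟩ ?_
    rintro r ⟨hr2, hr⟩
    obtain ⟨r, rfl⟩ := Nat.exists_eq_add_of_le' hr2
    have ha := haround r hr
    have hn := hnext r hr
    have ha' := haround p hp
    have hn' := hnext p hp
    have h6 : s (r + 6) = z := by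
      rcases hn.2 with h | h
      · exact h
      · exact absurd h.2.1 (hmix (p + 2) (r + 3) hp ha'.2.2.1 ha'.2.2.2 hn'.1 hp' ha.2.2.1
          ha.2.2.2 hn.1 h.1)
    refine ⟨⟨by omega, h6⟩, fun t ht => ?_⟩
    interval_cases t
    · exact hr
    · exact ha.2.2.1
    · exact ha.2.2.2
    · exact hn.1
  · push Not at hshort
    refine isEventuallyPeriodic_of_block (m := 7) (p₀ := p₀ + 2) (by omega)
      (fun p => 2 ≤ p ∧ s p = z)
      (fun t => if t = 0 then z else if t = 2 ∨ t = 5 then y else x) ⟨by omega, hp₀⟩ ?_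
    rintro r ⟨hr2, hr⟩
    obtain ⟨r, rfl⟩ := Nat.exists_eq_add_of_le' hr2
    have ha := haround r hr
    have hn := hnext r hr
    have h6 := hn.2.resolve_left (hshort r hr)
    refine ⟨⟨by omega, h6.2.2.2⟩, fun t ht => ?_⟩
    interval_cases t
    · exact hr
    · exact ha.2.2.1
    · exact ha.2.2.2
    · exact hn.1
    · exact h6.1
    · exact h6.2.1
    · exact h6.2.2.1

end ThreeLetters

/-! ### Frequencies in the colouring and failure of 1-balance -/

section Frequencies

variable {A : Type*}

/-- The letter `e` marks exactly the positions of `a` in `u`, so `u` can be read off its colouring.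
-/
theorem IsEventuallyPeriodic.of_colour {u : ℕ → AB} {e : A} {b : ℕ → A} (he : ∀ n, b n ≠ e)
    (h : IsEventuallyPeriodic (colour u (fun _ => e) b)) : IsEventuallyPeriodic u := by
  have hiff (n : ℕ) : colour u (fun _ => e) b n = e ↔ u n = AB.a := by
    unfold colour
    cases hn : u n <;> simp [he]
  obtain ⟨N, p, hp, hN⟩ := h
  refine ⟨N, p, hp, fun n hn => ?_⟩
  have h1 := hiff n
  have h2 := hiff (n + p)
  rw [hN n hn, h1] at h2
  cases h3 : u n <;> cases h4 : u (n + p) <;> simp_all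

variable [DecidableEq A]

theorem HasFrequency.other {x y : A} {s : ℕ → A} {f : ℝ} (hf : HasFrequency s y f)
    (hs : IsSturmian x y s) : HasFrequency s x (1 - f) := by
  refine (Filter.Tendsto.const_sub 1 hf).congr' ?_
  filter_upwards [Filter.eventually_gt_atTop 0] with n hn
  have h := hs.count_add_count (window_mem_language s 0 n)
  rw [window_length] at h
  have h' : ((window s 0 n).count x : ℝ) + (window s 0 n).count y = n := by exact_mod_cast h
  have : (n : ℝ) ≠ 0 := by positivity
  field_simp
  linarith

theorem hasFrequency_colour_const {u : ℕ → AB} {e : A} {b : ℕ → A} {f : ℝ}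
    (hu : HasFrequency u AB.a f) (he : ∀ n, b n ≠ e) :
    HasFrequency (colour u (fun _ => e) b) e f := by
  refine hu.congr fun n => ?_
  rw [count_window_colour, if_pos rfl, List.count_eq_zero_of_not_mem (l := window b _ _), add_zero]
  rw [mem_window_iff]
  rintro ⟨k, -, hk⟩
  exact he _ hk

theorem hasFrequency_colour {u : ℕ → AB} {e c : A} {b : ℕ → A} {α f : ℝ} (hα0 : 0 < α)
    (hu : HasFrequency u AB.b α) (hb : HasFrequency b c f) (hc : e ≠ c) :
    HasFrequency (colour u (fun _ => e) b) c (α * f) := by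
  have hinf : Filter.Tendsto (fun n => (window u 0 n).count AB.b) Filter.atTop Filter.atTop := by
    rw [← tendsto_natCast_atTop_iff (R := ℝ)]
    refine (hu.pos_mul_atTop hα0 tendsto_natCast_atTop_atTop).congr' ?_
    filter_upwards [Filter.eventually_gt_atTop 0] with n hn
    field_simp
  refine (Filter.Tendsto.mul hu (hb.comp hinf)).congr fun n => ?_
  rw [count_window_colour, if_neg hc, zero_add]
  simp only [Function.comp, window_zero, List.count_nil]
  rcases Nat.eq_zero_or_pos ((window u 0 n).count AB.b) with h | h
  · simp [h]
  · field_simp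

theorem not_isBalanced_one_colour {u : ℕ → AB} {e x y : A} {b : ℕ → A} {α γ : ℝ}
    (hu : IsSturmian AB.a AB.b u) (hα : HasFrequency u AB.b α) (hα0 : 0 < α)
    (hb : IsSturmian x y b) (hex : e ≠ x) (hey : e ≠ y) (hγ : HasFrequency b y γ)
    (hγ0 : 0 < γ) (hγ1 : γ < 1) (hne₁ : α ≠ 1 / (1 + γ)) (hne₂ : α ≠ 1 / (2 - γ))
    (hα1 : α < 1) : ¬ IsBalanced 1 (colour u (fun _ => e) b) := by
  intro hbal
  have he : ∀ n, b n ≠ e := fun n h => by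
    rcases hb.2.1 n with h' | h'
    · exact hex (h.symm.trans h')
    · exact hey (h.symm.trans h')
  apply hu.2.2.2
  apply IsEventuallyPeriodic.of_colour he
  have hfe := hasFrequency_colour_const (hα.other hu) he
  have hfx := hasFrequency_colour hα0 hα (hγ.other hb) hex
  have hfy := hasFrequency_colour hα0 hα hγ hey
  have hirr := hb.irrational (Or.inr rfl) hγ
  have hlet (n : ℕ) : colour u (fun _ => e) b n = e ∨ colour u (fun _ => e) b n = x ∨
      colour u (fun _ => e) b n = y := by
    unfold colour
    cases u n
    · exact Or.inl rfl
    · exact Or.inr (hb.2.1 _)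
  have hxy := hb.1
  -- The excluded values of `α` are those at which the frequency of `e` equals that of `x` or of
  -- `y`; a tie between `x` and `y` would need `γ = 1/2`.
  have h1 : 1 - α ≠ α * (1 - γ) := fun h => hne₂ (by
    rw [eq_div_iff (by linarith)]; linarith)
  have h2 : 1 - α ≠ α * γ := fun h => hne₁ (by
    rw [eq_div_iff (by linarith)]; linarith)
  have h3 : α * (1 - γ) ≠ α * γ := fun h => by
    have h4 := mul_left_cancel₀ hα0.ne' h
    refine hirr ⟨1 / 2, ?_⟩
    push_cast
    linarith
  have p1 : 0 < 1 - α := by linarith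
  have p2 : 0 < α * (1 - γ) := mul_pos hα0 (by linarith)
  have p3 : 0 < α * γ := by positivity
  -- Of the eight sign patterns, six order the frequencies strictly and two are cyclic, hence
  -- contradictory.
  rcases lt_or_gt_of_ne h1 with g1 | g1 <;> rcases lt_or_gt_of_ne h2 with g2 | g2 <;>
    rcases lt_or_gt_of_ne h3 with g3 | g3
  · exact hbal.isEventuallyPeriodic hxy.symm hey.symm hex.symm (fun n => by have := hlet n; tauto)
      hfy hfx hfe p1 g1 g3 (by ring)
  · exact hbal.isEventuallyPeriodic hxy hex.symm hey.symm (fun n => by have := hlet n; tauto)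
      hfx hfy hfe p1 g2 g3 (by ring)
  · linarith
  · exact hbal.isEventuallyPeriodic hex.symm hxy hey (fun n => by have := hlet n; tauto)
      hfx hfe hfy p3 g2 g1 (by ring)
  · exact hbal.isEventuallyPeriodic hey.symm hxy.symm hex (fun n => by have := hlet n; tauto)
      hfy hfe hfx p2 g1 g2 (by ring)
  · linarith
  · exact hbal.isEventuallyPeriodic hey hex hxy.symm (fun n => by have := hlet n; tauto)
      hfe hfy hfx p2 g3 g2 (by ring)
  · exact hbal.isEventuallyPeriodic hex hey hxy (fun n => by have := hlet n; tauto)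
      hfe hfx hfy p3 g3 g1 (by ring)

end Frequencies

end InfWord

theorem mainTheorem2 (u : ℕ → InfWord.AB) (b : ℕ → ℕ) (α : ℝ)
    (hu : InfWord.IsSturmian InfWord.AB.a InfWord.AB.b u)
    (hα : InfWord.HasFrequency u InfWord.AB.b α)
    (hirr : Irrational α) (hα0 : 0 < α) (hα1 : α < 1)
    (hb : InfWord.IsSturmian 2 3 b)
    (v : ℕ → ℕ) (hv : v = InfWord.colour u (fun _ => 1) b) :
    InfWord.IsBalanced 2 v ∧
    (∃ γ : ℝ, 0 < γ ∧ γ < 1 ∧ InfWord.HasFrequency b 3 γ ∧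
      (α ∉ ({1 / (1 + γ), 1 / (2 - γ)} : Set ℝ) → ¬ InfWord.IsBalanced 1 v)) ∧
    (∀ w : ℕ → InfWord.AB, InfWord.IsSturmian InfWord.AB.a InfWord.AB.b w →
      InfWord.HasFrequency w InfWord.AB.b α → ∀ n : ℕ, 1 ≤ n →
        InfWord.factorComplexity v n ≤
          InfWord.parikhCount w α n + (n + 1) * ⌈(n : ℝ) * α⌉₊) ∧
    (∀ n : ℕ, 1 ≤ n → InfWord.abelianComplexity v n ≤ 4) := by
  subst hv
  obtain ⟨γ, hγ, hγ0, hγ1⟩ := hb.2.2.1.exists_hasFrequency 3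
  have hγirr := hb.irrational (Or.inr rfl) hγ
  have hγ0' : 0 < γ := lt_of_le_of_ne hγ0 hγirr.ne_zero.symm
  have hγ1' : γ < 1 := lt_of_le_of_ne hγ1 hγirr.ne_one
  refine ⟨InfWord.isBalanced_two_colour hu hb.2.2.1 fun n => ?_, ⟨γ, hγ0', hγ1', hγ, fun hne => ?_⟩,
    fun w hw hwα n hn => InfWord.factorComplexity_colour_le hu hα hirr hα0 hα1 hb hw hwα hn,
    fun n _ => InfWord.abelianComplexity_colour_le hu hb n⟩
  · rcases hb.2.1 n with h | h <;> omega
  · simp only [Set.mem_insert_iff, Set.mem_singleton_iff, not_or] at hne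
    exact InfWord.not_isBalanced_one_colour hu hα hα0 hb (by norm_num) (by norm_num) hγ hγ0' hγ1'
      hne.1 hne.2 hα1
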